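/- A residuated lattice is an algebra $(A,\vee,\wedge,\odot,\to,0,1)$ such that $(A,\vee,\wedge,0,1)$ is a bounded lattice, $(A,\odot,1)$ is a commutative monoid, and $a\le b\to c$ iff $a\odot b\le c$ for all $a,b,c\in A$. Put $\neg a=a\to 0$ and let $\mathcal B(A)$ be the set of complemented elements of the bounded lattice $A$. $A$ is a BL-algebra if $(a\to b)\vee(b\to a)=1$ and $a\wedge b=a\odot(a\to b)$ for all $a,b$; an MV-algebra is a BL-algebra with $\neg\neg a=a$ for all $a$. A filter of $A$ is a non-empty subset closed under $\odot$ and upward closed; $[X)$ denotes the filter generated by $X\subseteq A$, $[x)=[\{x\})$, and $F\vee G=[F\cup G)$. A filter is proper if it is not $A$; maximal filters are the maximal proper filters; a proper filter $P$ is prime if $a\vee b\in P$ implies $a\in P$ or $b\in P$. $\mathrm{Rad}(A)$ is the intersection of all maximal filters (equal to $A$ if there are none). For a filter $F$, $a/F$ denotes the class of $a$ for the congruence $x\equiv y \pmod F$ iff $(x\to y)\wedge(y\to x)\in F$, and $A/F$ is the quotient residuated lattice. $A$ is local if it has exactly one maximal filter; semilocal if it has finitely many maximal filters; maximal if, for every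 non-empty index set $I$ and all families $(a_i)_{i\in I}$ of elements and $(F_i)_{i\in I}$ of filters of $A$ such that $\bigcap_{j\in J}a_j/F_j\neq\emptyset$ for every finite $J\subseteq I$ (the empty intersection being $A$), one has $\bigcap_{i\in I}a_i/F_i\neq\emptyset$; Gelfand if every prime filter is included in a unique maximal filter. $A$ has the Boolean Lifting Property (BLP) if, for every filter $F$ and every $a\in A$ with $a/F\in\mathcal B(A/F)$, there is $e\in\mathcal B(A)$ with $a/F=e/F$. $A$ satisfies $(\star)$ if for every $x\in A$ there are $u\in\mathrm{Rad}(A)$ and $e\in\mathcal B(A)$ with $[x)=[u)\vee[e)$. Then the following hold. 1. Every semilocal Gelfand residuated lattice has BLP. In particular, semilocal MV-algebras, semilocal BL-algebras and maximal Gelfand residuated lattices have BLP. 2. Every semilocal Gelfand residuated lattice satisfies $(\star)$. In particular, semilocal MV-algebras, semilocal BL-algebras and maximal Gelfand residuated lattices satisfy $(\star)$. 3. Every semilocal Gelfand residuated lattice is isomorphic to a finite direct product of local residuated lattices. 4. Every maximal Gelfand residuated lattice is isomorphic to a finite direct product of local maximal residuated lattices. In 3 and 4 the empty product, i.e. the one-element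 residuated lattice, is allowed. -/

import Mathlib

universe u v

/-- A commutative integral bounded residuated lattice `(A, ⊔, ⊓, *, ⇨, ⊥, 1)`: a bounded lattice
with a commutative monoid structure whose unit is the top element, satisfying the law of
residuation. -/
class ResiduatedLattice (A : Type u) extends Lattice A, BoundedOrder A, CommMonoid A, HImp A where
  one_eq_top : (1 : A) = ⊤
  residuation : ∀ a b c : A, a ≤ b ⇨ c ↔ a * b ≤ c

namespace ResiduatedLattice

section Basic

variable {A : Type u} [ResiduatedLattice A]

theorem le_one' (a : A) : a ≤ 1 := by
  rw [one_eq_top]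
  exact le_top

theorem mul_le_mul_r {a b : A} (h : a ≤ b) (c : A) : a * c ≤ b * c :=
  (residuation _ _ _).1 (h.trans ((residuation _ _ _).2 le_rfl))

theorem mul_le_mul_l {a b : A} (h : a ≤ b) (c : A) : c * a ≤ c * b := by
  rw [mul_comm c a, mul_comm c b]
  exact mul_le_mul_r h c

theorem mul_mono {a b c d : A} (h : a ≤ b) (h' : c ≤ d) : a * c ≤ b * d :=
  (mul_le_mul_r h c).trans (mul_le_mul_l h' b)

theorem mul_le_fst (a b : A) : a * b ≤ a := by
  simpa using mul_le_mul_l (le_one' b) a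

theorem mul_le_snd (a b : A) : a * b ≤ b := by
  simpa using mul_le_mul_r (le_one' a) b

end Basic

/-- The direct product of a family of residuated lattices, with componentwise operations. -/
instance instPi {ι : Type v} {B : ι → Type u} [∀ i, ResiduatedLattice (B i)] :
    ResiduatedLattice (∀ i, B i) where
  himp a b := fun i => a i ⇨ b i
  one_eq_top := funext fun _ => one_eq_top
  residuation _ _ _ := forall_congr' fun _ => residuation _ _ _

/-- Isomorphisms of residuated lattices: bijections preserving all operations and constants. -/
structure Iso (A : Type u) (B : Type v) [ResiduatedLattice A] [ResiduatedLattice B]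
    extends A ≃ B where
  map_sup : ∀ a b, toFun (a ⊔ b) = toFun a ⊔ toFun b
  map_inf : ∀ a b, toFun (a ⊓ b) = toFun a ⊓ toFun b
  map_mul : ∀ a b, toFun (a * b) = toFun a * toFun b
  map_himp : ∀ a b, toFun (a ⇨ b) = toFun a ⇨ toFun b
  map_bot : toFun ⊥ = ⊥
  map_one : toFun 1 = 1

/-- A filter of a residuated lattice (the improper filter is allowed). -/
@[ext]
structure Filt (A : Type u) [ResiduatedLattice A] where
  carrier : Set A
  nonempty : carrier.Nonempty
  mul_mem : ∀ {a b : A}, a ∈ carrier → b ∈ carrier → a * b ∈ carrier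
  mem_of_le : ∀ {a b : A}, a ∈ carrier → a ≤ b → b ∈ carrier

namespace Filt

variable {A : Type u} [ResiduatedLattice A]

theorem one_mem (F : Filt A) : (1 : A) ∈ F.carrier := by
  obtain ⟨a, ha⟩ := F.nonempty
  exact F.mem_of_le ha (le_one' a)

/-- Proper filters. -/
def IsProper (F : Filt A) : Prop := F.carrier ≠ Set.univ

/-- Maximal filters: the maximal elements, for inclusion, among the proper filters. -/
def IsMaximal (M : Filt A) : Prop :=
  M.IsProper ∧ ∀ G : Filt A, G.IsProper → M.carrier ⊆ G.carrier → G = M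

/-- Prime filters. -/
def IsPrime (P : Filt A) : Prop :=
  P.IsProper ∧ ∀ a b : A, a ⊔ b ∈ P.carrier → a ∈ P.carrier ∨ b ∈ P.carrier

/-- The intersection of a set of filters (the improper filter if the set is empty). -/
def inter (S : Set (Filt A)) : Filt A where
  carrier := {a | ∀ F ∈ S, a ∈ F.carrier}
  nonempty := ⟨1, fun F _ => F.one_mem⟩
  mul_mem := fun ha hb F hF => F.mul_mem (ha F hF) (hb F hF)
  mem_of_le := fun ha hab F hF => F.mem_of_le (ha F hF) hab

/-- The filter `[X)` generated by a set `X`. -/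
def gen (X : Set A) : Filt A := inter {F | X ⊆ F.carrier}

/-- The principal filter `[x)`. -/
def principal (x : A) : Filt A := gen {x}

/-- The join `F ∨ G` of two filters. -/
def join (F G : Filt A) : Filt A := gen (F.carrier ∪ G.carrier)

/-- Congruence modulo `F`: the biresiduum of `a` and `b` belongs to `F`. -/
def Rel (F : Filt A) (a b : A) : Prop := (a ⇨ b) ⊓ (b ⇨ a) ∈ F.carrier

/-- The congruence class `a/F`, as a subset of `A`. -/
def cls (F : Filt A) (a : A) : Set A := {x | F.Rel x a}

theorem himp_mem_iff (F : Filt A) (a b : A) :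
    a ⇨ b ∈ F.carrier ↔ ∃ f ∈ F.carrier, f * a ≤ b :=
  ⟨fun h => ⟨_, h, (residuation _ _ _).1 le_rfl⟩,
    fun ⟨_, hf, h⟩ => F.mem_of_le hf ((residuation _ _ _).2 h)⟩

theorem rel_iff (F : Filt A) (a b : A) :
    F.Rel a b ↔ a ⇨ b ∈ F.carrier ∧ b ⇨ a ∈ F.carrier :=
  ⟨fun h => ⟨F.mem_of_le h inf_le_left, F.mem_of_le h inf_le_right⟩,
    fun h => F.mem_of_le (F.mul_mem h.1 h.2) (le_inf (mul_le_fst _ _) (mul_le_snd _ _))⟩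

theorem himp_mem_of_le (F : Filt A) {a b : A} (h : a ≤ b) : a ⇨ b ∈ F.carrier :=
  (F.himp_mem_iff _ _).2 ⟨1, F.one_mem, by simpa using h⟩

theorem himp_mem_trans (F : Filt A) {a b c : A} (h : a ⇨ b ∈ F.carrier)
    (h' : b ⇨ c ∈ F.carrier) : a ⇨ c ∈ F.carrier := by
  rw [himp_mem_iff] at *
  obtain ⟨f, hf, h⟩ := h
  obtain ⟨g, hg, h'⟩ := h'
  refine ⟨g * f, F.mul_mem hg hf, ?_⟩
  rw [mul_assoc]
  exact (mul_le_mul_l h g).trans h'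

theorem himp_mem_sup (F : Filt A) {a b c : A} (h : a ⇨ c ∈ F.carrier)
    (h' : b ⇨ c ∈ F.carrier) : (a ⊔ b) ⇨ c ∈ F.carrier := by
  rw [himp_mem_iff] at *
  obtain ⟨f, hf, h⟩ := h
  obtain ⟨g, hg, h'⟩ := h'
  refine ⟨f * g, F.mul_mem hf hg, ?_⟩
  rw [mul_comm, ← residuation]
  refine sup_le ?_ ?_
  · rw [residuation, mul_comm]
    exact (mul_le_mul_r (mul_le_fst f g) a).trans h
  · rw [residuation, mul_comm]
    exact (mul_le_mul_r (mul_le_snd f g) b).trans h'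

theorem himp_mem_inf (F : Filt A) {a b c : A} (h : c ⇨ a ∈ F.carrier)
    (h' : c ⇨ b ∈ F.carrier) : c ⇨ (a ⊓ b) ∈ F.carrier := by
  rw [himp_mem_iff] at *
  obtain ⟨f, hf, h⟩ := h
  obtain ⟨g, hg, h'⟩ := h'
  exact ⟨f * g, F.mul_mem hf hg, le_inf ((mul_le_mul_r (mul_le_fst f g) c).trans h)
    ((mul_le_mul_r (mul_le_snd f g) c).trans h')⟩

theorem himp_mem_mul (F : Filt A) {a b c d : A} (h : a ⇨ b ∈ F.carrier)
    (h' : c ⇨ d ∈ F.carrier) : (a * c) ⇨ (b * d) ∈ F.carrier := by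
  rw [himp_mem_iff] at *
  obtain ⟨f, hf, h⟩ := h
  obtain ⟨g, hg, h'⟩ := h'
  refine ⟨f * g, F.mul_mem hf hg, ?_⟩
  rw [mul_mul_mul_comm]
  exact mul_mono h h'

theorem himp_mem_residuation (F : Filt A) (a b c : A) :
    a ⇨ (b ⇨ c) ∈ F.carrier ↔ (a * b) ⇨ c ∈ F.carrier := by
  simp only [himp_mem_iff, residuation, mul_assoc]

theorem himp_mem_himp (F : Filt A) {a b c d : A} (h : b ⇨ a ∈ F.carrier)
    (h' : c ⇨ d ∈ F.carrier) : (a ⇨ c) ⇨ (b ⇨ d) ∈ F.carrier := by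
  rw [himp_mem_residuation]
  refine F.himp_mem_trans (F.himp_mem_mul (F.himp_mem_of_le le_rfl) h) ?_
  exact F.himp_mem_trans (F.himp_mem_of_le ((residuation _ _ _).1 le_rfl)) h'

/-- Congruence modulo `F` as an equivalence relation. -/
def setoid (F : Filt A) : Setoid A where
  r := F.Rel
  iseqv :=
    { refl := fun a => (F.rel_iff a a).2
        ⟨F.himp_mem_of_le le_rfl, F.himp_mem_of_le le_rfl⟩
      symm := fun {a b} h => by
        rw [rel_iff] at *
        exact h.symm
      trans := fun {a b c} h h' => by
        rw [rel_iff] at *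
        exact ⟨F.himp_mem_trans h.1 h'.1, F.himp_mem_trans h'.2 h.2⟩ }

/-- The quotient `A/F`. -/
def Quot (F : Filt A) : Type u := Quotient F.setoid

/-- The canonical surjection from `A` onto `A/F`. -/
def toQuot (F : Filt A) (a : A) : F.Quot := Quotient.mk F.setoid a

theorem toQuot_eq_iff (F : Filt A) (a b : A) : F.toQuot a = F.toQuot b ↔ F.Rel a b :=
  Quotient.eq (r := F.setoid)

/-- The order of `A/F`: `a/F ≤ b/F` iff `a ⇨ b ∈ F`. -/
instance instPartialOrderQuot (F : Filt A) : PartialOrder F.Quot where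
  le := Quotient.lift₂ (fun a b => a ⇨ b ∈ F.carrier) fun a b c d h h' => by
    have h1 := (F.rel_iff _ _).1 h
    have h2 := (F.rel_iff _ _).1 h'
    exact propext ⟨fun k => F.himp_mem_trans (F.himp_mem_trans h1.2 k) h2.1,
      fun k => F.himp_mem_trans (F.himp_mem_trans h1.1 k) h2.2⟩
  le_refl := fun a => Quotient.inductionOn a fun _ => F.himp_mem_of_le le_rfl
  le_trans := fun a b c => Quotient.inductionOn₃ a b c fun _ _ _ h h' => F.himp_mem_trans h h'
  le_antisymm := fun a b => Quotient.inductionOn₂ a b fun _ _ h h' =>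
    Quotient.sound ((F.rel_iff _ _).2 ⟨h, h'⟩)

/-- The residuated lattice `A/F`, with the operations induced by those of `A`. -/
instance instQuot (F : Filt A) : ResiduatedLattice F.Quot where
  sup := Quotient.map₂ (· ⊔ ·) fun a b h c d h' => by
    have h1 := (F.rel_iff _ _).1 h
    have h2 := (F.rel_iff _ _).1 h'
    exact (F.rel_iff _ _).2
      ⟨F.himp_mem_sup (F.himp_mem_trans h1.1 (F.himp_mem_of_le le_sup_left))
        (F.himp_mem_trans h2.1 (F.himp_mem_of_le le_sup_right)),
       F.himp_mem_sup (F.himp_mem_trans h1.2 (F.himp_mem_of_le le_sup_left))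
        (F.himp_mem_trans h2.2 (F.himp_mem_of_le le_sup_right))⟩
  inf := Quotient.map₂ (· ⊓ ·) fun a b h c d h' => by
    have h1 := (F.rel_iff _ _).1 h
    have h2 := (F.rel_iff _ _).1 h'
    exact (F.rel_iff _ _).2
      ⟨F.himp_mem_inf (F.himp_mem_trans (F.himp_mem_of_le inf_le_left) h1.1)
        (F.himp_mem_trans (F.himp_mem_of_le inf_le_right) h2.1),
       F.himp_mem_inf (F.himp_mem_trans (F.himp_mem_of_le inf_le_left) h1.2)
        (F.himp_mem_trans (F.himp_mem_of_le inf_le_right) h2.2)⟩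
  mul := Quotient.map₂ (· * ·) fun a b h c d h' => by
    have h1 := (F.rel_iff _ _).1 h
    have h2 := (F.rel_iff _ _).1 h'
    exact (F.rel_iff _ _).2 ⟨F.himp_mem_mul h1.1 h2.1, F.himp_mem_mul h1.2 h2.2⟩
  himp := Quotient.map₂ (· ⇨ ·) fun a b h c d h' => by
    have h1 := (F.rel_iff _ _).1 h
    have h2 := (F.rel_iff _ _).1 h'
    exact (F.rel_iff _ _).2 ⟨F.himp_mem_himp h1.2 h2.1, F.himp_mem_himp h1.1 h2.2⟩
  one := F.toQuot 1
  top := F.toQuot ⊤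
  bot := F.toQuot ⊥
  le_top := fun a => Quotient.inductionOn a fun _ => F.himp_mem_of_le le_top
  bot_le := fun a => Quotient.inductionOn a fun _ => F.himp_mem_of_le bot_le
  le_sup_left := fun a b => Quotient.inductionOn₂ a b fun _ _ => F.himp_mem_of_le le_sup_left
  le_sup_right := fun a b => Quotient.inductionOn₂ a b fun _ _ => F.himp_mem_of_le le_sup_right
  sup_le := fun a b c => Quotient.inductionOn₃ a b c fun _ _ _ h h' => F.himp_mem_sup h h'
  inf_le_left := fun a b => Quotient.inductionOn₂ a b fun _ _ => F.himp_mem_of_le inf_le_left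
  inf_le_right := fun a b => Quotient.inductionOn₂ a b fun _ _ => F.himp_mem_of_le inf_le_right
  le_inf := fun a b c => Quotient.inductionOn₃ a b c fun _ _ _ h h' => F.himp_mem_inf h h'
  mul_assoc := fun a b c => Quotient.inductionOn₃ a b c fun a b c =>
    congrArg F.toQuot (mul_assoc a b c)
  mul_comm := fun a b => Quotient.inductionOn₂ a b fun a b => congrArg F.toQuot (mul_comm a b)
  one_mul := fun a => Quotient.inductionOn a fun a => congrArg F.toQuot (one_mul a)
  mul_one := fun a => Quotient.inductionOn a fun a => congrArg F.toQuot (mul_one a)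
  one_eq_top := congrArg F.toQuot one_eq_top
  residuation := fun a b c => Quotient.inductionOn₃ a b c fun a b c =>
    F.himp_mem_residuation a b c

/-- The Boolean Lifting Property of a filter `F`: every complemented element of `A/F` is the
class of a complemented element of `A`. -/
def HasBLP (F : Filt A) : Prop :=
  ∀ a : A, IsComplemented (F.toQuot a) → ∃ e : A, IsComplemented e ∧ F.toQuot a = F.toQuot e

end Filt

variable (A : Type u) [ResiduatedLattice A]

/-- The radical: the intersection of all maximal filters. -/
def rad : Filt A := Filt.inter {M | M.IsMaximal}

/-- Exactly one maximal filter. -/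
def IsLocal : Prop := ∃! M : Filt A, M.IsMaximal

/-- Only finitely many maximal filters. -/
def IsSemilocal : Prop := {M : Filt A | M.IsMaximal}.Finite

/-- Maximal residuated lattices: a family of congruence classes `aᵢ/Fᵢ`, indexed by a non-empty
set, has a common element as soon as each of its finite subfamilies does. Index types in the
universe of `A` suffice, as a family may be replaced by the set of its values. -/
def IsMaximalRL : Prop :=
  ∀ (I : Type u) [Nonempty I] (a : I → A) (F : I → Filt A),
    (∀ J : Finset I, (⋂ j ∈ J, (F j).cls (a j)).Nonempty) → (⋂ i, (F i).cls (a i)).Nonempty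

/-- The Gelfand property: every prime filter is included in a unique maximal filter. -/
def IsGelfand : Prop :=
  ∀ P : Filt A, P.IsPrime → ∃! M : Filt A, M.IsMaximal ∧ P.carrier ⊆ M.carrier

/-- The Boolean Lifting Property of a residuated lattice: every filter has it. -/
def HasBLP : Prop := ∀ F : Filt A, F.HasBLP

/-- The property `(⋆)`: for every `x` there are `u ∈ Rad(A)` and a complemented `e` with
`[x) = [u) ∨ [e)`. -/
def HasStar : Prop :=
  ∀ x : A, ∃ u ∈ (rad A).carrier, ∃ e : A, IsComplemented e ∧
    Filt.principal x = Filt.join (Filt.principal u) (Filt.principal e)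

/-- BL-algebras: the residuated lattices that are prelinear and divisible. -/
def IsBL : Prop :=
  (∀ a b : A, (a ⇨ b) ⊔ (b ⇨ a) = 1) ∧ ∀ a b : A, a ⊓ b = a * (a ⇨ b)

/-- MV-algebras, as the involutive BL-algebras. -/
def IsMV : Prop := IsBL A ∧ ∀ a : A, (a ⇨ ⊥) ⇨ ⊥ = a

end ResiduatedLattice

/-! Everything rests on `IsGelfand.exists_compl`: when `A` is Gelfand with finitely many maximal
filters, complemented elements cut out arbitrary sets of them. The Gelfand property gives `a ∉ M`,
`b ∉ N` with `a ⊔ b = 1` for distinct maximal `M`, `N`; finite combinations do this for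
complementary sets of maximal filters. Then `a * b` lies in no maximal filter, so it is nilpotent,
while `a ^ k ⊔ b ^ k = 1` persists: for suitable `k` these powers are complements.

BLP and (⋆) follow by choosing the `e` that lies in the same maximal filters as the given element.
Singletons yield orthogonal idempotents with join `1`, hence the product of local quotients. An
idempotent outside all maximal filters is nilpotent, hence `⊥`; this gives most of the required
identities.

Maximal residuated lattices reduce to this case by `IsMaximalRL.isSemilocal`, a compactness
argument, and `IsMaximalRL.quot` makes the factors maximal. -/

namespace ResiduatedLattice

/-! ### Arithmetic of products, powers and complements. -/

section Arithmetic

variable {A : Type u} [ResiduatedLattice A]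

theorem mul_sup_distrib (a b c : A) : a * (b ⊔ c) = a * b ⊔ a * c := by
  apply le_antisymm
  · rw [mul_comm, ← residuation]
    refine sup_le ?_ ?_ <;> rw [residuation, mul_comm]
    · exact le_sup_left
    · exact le_sup_right
  · exact sup_le (mul_le_mul_l le_sup_left a) (mul_le_mul_l le_sup_right a)

theorem mul_bot_eq (a : A) : a * ⊥ = ⊥ := le_antisymm (mul_le_snd _ _) bot_le

theorem himp_mul_le (a b : A) : (a ⇨ b) * a ≤ b := (residuation _ _ _).1 le_rfl

theorem le_of_dvd' {a b : A} (h : a ∣ b) : b ≤ a := by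
  obtain ⟨c, rfl⟩ := h
  exact mul_le_fst _ _

/-- After expansion, every term except `a * b` has a factor `c`. -/
theorem sup_mul_sup_le (a b c : A) : (a ⊔ c) * (b ⊔ c) ≤ a * b ⊔ c := by
  rw [mul_sup_distrib, mul_comm _ b, mul_sup_distrib, mul_comm b a]
  exact sup_le (sup_le_sup_left (mul_le_snd _ _) _) ((mul_le_snd _ _).trans le_sup_right)

theorem mul_sup_eq_one {a b c : A} (ha : a ⊔ c = 1) (hb : b ⊔ c = 1) : a * b ⊔ c = 1 :=
  le_antisymm (le_one' _) (by simpa [ha, hb] using sup_mul_sup_le a b c)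

theorem pow_le_pow_of_le {a b : A} (h : a ≤ b) (k : ℕ) : a ^ k ≤ b ^ k := by
  induction k with
  | zero => simp
  | succ k ih => simpa only [pow_succ] using mul_mono ih h

theorem sup_pow_le (a c : A) (k : ℕ) : (a ⊔ c) ^ k ≤ a ^ k ⊔ c := by
  induction k with
  | zero => simp
  | succ k ih =>
    simp only [pow_succ]
    exact (mul_le_mul_r ih _).trans (sup_mul_sup_le _ _ _)

theorem sup_pow_mul_le (a c : A) (k m : ℕ) : (a ⊔ c) ^ (k * m) ≤ a ^ k ⊔ c ^ m := by
  rw [pow_mul]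
  refine (pow_le_pow_of_le (sup_pow_le a c k) m).trans ?_
  rw [sup_comm, sup_comm (a ^ k)]
  exact sup_pow_le c (a ^ k) m

theorem pow_sup_pow_eq_one {a c : A} (h : a ⊔ c = 1) (k m : ℕ) : a ^ k ⊔ c ^ m = 1 :=
  le_antisymm (le_one' _) (by simpa [h] using sup_pow_mul_le a c k m)

/-- The conditions on `a` and `b` say that they are complements of each other. -/
theorem isCompl_of_mul {a b : A} (h : a ⊔ b = 1) (h' : a * b = ⊥) : IsCompl a b := by
  refine IsCompl.of_eq ?_ (h.trans one_eq_top)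
  refine le_antisymm ?_ bot_le
  calc a ⊓ b = (a ⊓ b) * (a ⊔ b) := by rw [h, mul_one]
    _ = (a ⊓ b) * a ⊔ (a ⊓ b) * b := mul_sup_distrib _ _ _
    _ ≤ ⊥ := sup_le
      (by rw [mul_comm, ← h']; exact mul_le_mul_l inf_le_right a)
      (by rw [← h']; exact mul_le_mul_r inf_le_left b)

theorem sup_eq_one_of_isCompl {a b : A} (h : IsCompl a b) : a ⊔ b = 1 :=
  h.sup_eq_top.trans one_eq_top.symm

theorem mul_eq_bot_of_isCompl {a b : A} (h : IsCompl a b) : a * b = ⊥ :=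
  le_antisymm ((le_inf (mul_le_fst _ _) (mul_le_snd _ _)).trans h.inf_eq_bot.le) bot_le

theorem le_of_mul_eq_bot {a b c : A} (h : b ⊔ c = 1) (h' : a * c = ⊥) : a ≤ b := by
  calc a = a * (b ⊔ c) := by rw [h, mul_one]
    _ = a * b := by rw [mul_sup_distrib, h', sup_bot_eq]
    _ ≤ b := mul_le_snd _ _

theorem mul_self_of_compl {a b : A} (h : a ⊔ b = 1) (h' : a * b = ⊥) : a * a = a := by
  calc a * a = a * (a ⊔ b) := by rw [mul_sup_distrib, h', sup_bot_eq]
    _ = a := by rw [h, mul_one]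

theorem le_pow_of_mul_self {a : A} (h : a * a = a) (k : ℕ) : a ≤ a ^ k := by
  induction k with
  | zero => simpa using le_one' a
  | succ k ih =>
    rw [pow_succ]
    calc a = a * a := h.symm
      _ ≤ a ^ k * a := mul_le_mul_r ih a

/-- Combined with `exists_pow_eq_bot`, this makes an idempotent outside every maximal filter vanish.
-/
theorem eq_bot_of_pow_eq_bot {a : A} (h : a * a = a) {k : ℕ} (hk : a ^ k = ⊥) : a = ⊥ :=
  le_antisymm ((le_pow_of_mul_self h k).trans hk.le) bot_le

theorem mul_mul_self {a b : A} (ha : a * a = a) (hb : b * b = b) : a * b * (a * b) = a * b := by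
  rw [mul_mul_mul_comm, ha, hb]

end Arithmetic

/-! ### Prime and maximal filters, and quotients. -/

namespace Filt

variable {A : Type u} [ResiduatedLattice A]

theorem isProper_iff (F : Filt A) : F.IsProper ↔ ⊥ ∉ F.carrier := by
  refine ⟨fun h h' => h (Set.eq_univ_of_forall fun a => F.mem_of_le h' bot_le), fun h h' => h ?_⟩
  rw [h']
  trivial

theorem mul_mem_iff (F : Filt A) {a b : A} :
    a * b ∈ F.carrier ↔ a ∈ F.carrier ∧ b ∈ F.carrier :=
  ⟨fun h => ⟨F.mem_of_le h (mul_le_fst _ _), F.mem_of_le h (mul_le_snd _ _)⟩,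
    fun h => F.mul_mem h.1 h.2⟩

theorem pow_mem (F : Filt A) {a : A} (h : a ∈ F.carrier) (k : ℕ) : a ^ k ∈ F.carrier := by
  induction k with
  | zero => simpa using F.one_mem
  | succ k ih =>
    rw [pow_succ]
    exact F.mul_mem ih h

theorem mem_of_pow_mem (F : Filt A) {a : A} {k : ℕ} (hk : k ≠ 0) (h : a ^ k ∈ F.carrier) :
    a ∈ F.carrier :=
  F.mem_of_le h (le_of_dvd' (dvd_pow_self a hk))

theorem mem_of_himp_mem (F : Filt A) {a b : A} (h : a ⇨ b ∈ F.carrier) (ha : a ∈ F.carrier) :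
    b ∈ F.carrier :=
  F.mem_of_le (F.mul_mem h ha) (himp_mul_le a b)

/-- The least filter, `{1}`. -/
def trivialFilt (A : Type u) [ResiduatedLattice A] : Filt A where
  carrier := {1}
  nonempty := ⟨1, rfl⟩
  mul_mem := by rintro a b rfl rfl; exact mul_one _
  mem_of_le := by rintro a b rfl h; exact le_antisymm (le_one' _) h

/-- The filter generated by a filter and an element. -/
def adjoin (F : Filt A) (x : A) : Filt A where
  carrier := {a | ∃ f ∈ F.carrier, ∃ k : ℕ, f * x ^ k ≤ a}
  nonempty := ⟨1, 1, F.one_mem, 0, le_one' _⟩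
  mul_mem := by
    rintro a b ⟨f, hf, k, h⟩ ⟨g, hg, m, h'⟩
    refine ⟨f * g, F.mul_mem hf hg, k + m, ?_⟩
    rw [pow_add, mul_mul_mul_comm]
    exact mul_mono h h'
  mem_of_le := by
    rintro a b ⟨f, hf, k, h⟩ hab
    exact ⟨f, hf, k, h.trans hab⟩

theorem subset_adjoin (F : Filt A) (x : A) : F.carrier ⊆ (F.adjoin x).carrier :=
  fun f hf => ⟨f, hf, 0, by simp⟩

theorem mem_adjoin_self (F : Filt A) (x : A) : x ∈ (F.adjoin x).carrier :=
  ⟨1, F.one_mem, 1, by simp⟩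

/-- If `a` is above `f * x ^ k` and `g * y ^ m`, it is above `f * g * (x ⊔ y) ^ (k * m)`. This is
the source of primeness. -/
theorem mem_of_mem_adjoin_of_mem_adjoin (F : Filt A) {x y a : A} (hxy : x ⊔ y ∈ F.carrier)
    (hx : a ∈ (F.adjoin x).carrier) (hy : a ∈ (F.adjoin y).carrier) : a ∈ F.carrier := by
  obtain ⟨f, hf, k, h⟩ := hx
  obtain ⟨g, hg, m, h'⟩ := hy
  refine F.mem_of_le (F.mul_mem (F.mul_mem hf hg) (F.pow_mem hxy (k * m))) ?_
  refine (mul_le_mul_l (sup_pow_mul_le x y k m) _).trans ?_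
  rw [mul_sup_distrib]
  exact sup_le ((mul_le_mul_r (mul_le_fst f g) _).trans h)
    ((mul_le_mul_r (mul_le_snd f g) _).trans h')

/-- Zorn's lemma: the union of a non-empty chain of filters is a filter. `T = {⊥}` produces maximal
filters, other join-closed `T` produce primes. -/
theorem exists_maximal_disjoint (F : Filt A) (T : Set A) (h : ∀ x ∈ F.carrier, x ∉ T) :
    ∃ P : Filt A, F.carrier ⊆ P.carrier ∧ (∀ x ∈ P.carrier, x ∉ T) ∧
      ∀ G : Filt A, P.carrier ⊆ G.carrier → (∀ x ∈ G.carrier, x ∉ T) → G = P := by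
  have hchains : ∀ c ⊆ {X : Set A | ∃ G : Filt A, G.carrier = X ∧ ∀ x ∈ X, x ∉ T},
      IsChain (· ⊆ ·) c → c.Nonempty →
      ∃ ub ∈ {X : Set A | ∃ G : Filt A, G.carrier = X ∧ ∀ x ∈ X, x ∉ T}, ∀ s ∈ c, s ⊆ ub := by
    intro c hc hchain ⟨X₀, hX₀⟩
    refine ⟨⋃₀ c, ⟨⟨⋃₀ c, ?_, ?_, ?_⟩, rfl, ?_⟩, fun s hs => Set.subset_sUnion_of_mem hs⟩
    · obtain ⟨G, rfl, -⟩ := hc hX₀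
      exact ⟨1, _, hX₀, G.one_mem⟩
    · rintro a b ⟨X, hX, ha⟩ ⟨Y, hY, hb⟩
      rcases hchain.total hX hY with hXY | hXY
      · obtain ⟨G, rfl, -⟩ := hc hY
        exact ⟨_, hY, G.mul_mem (hXY ha) hb⟩
      · obtain ⟨G, rfl, -⟩ := hc hX
        exact ⟨_, hX, G.mul_mem ha (hXY hb)⟩
    · rintro a b ⟨X, hX, ha⟩ hab
      obtain ⟨G, rfl, -⟩ := hc hX
      exact ⟨_, hX, G.mem_of_le ha hab⟩
    · rintro x ⟨X, hX, hx⟩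
      obtain ⟨G, rfl, hG⟩ := hc hX
      exact hG x hx
  obtain ⟨m, hFm, hm⟩ := zorn_subset_nonempty _ hchains F.carrier ⟨F, rfl, h⟩
  obtain ⟨P, rfl, hP⟩ := hm.prop
  exact ⟨P, hFm, hP, fun G hG hT =>
    Filt.ext (Set.Subset.antisymm (hm.le_of_ge ⟨G, rfl, hT⟩ hG) hG)⟩

/-- A filter that is maximal among those disjoint from a set closed under joins is prime. -/
theorem isPrime_of_maximal_disjoint {P : Filt A} {T : Set A} (hne : T.Nonempty)
    (hT : ∀ a ∈ T, ∀ b ∈ T, a ⊔ b ∈ T) (hP : ∀ x ∈ P.carrier, x ∉ T)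
    (hmax : ∀ G : Filt A, P.carrier ⊆ G.carrier → (∀ x ∈ G.carrier, x ∉ T) → G = P) :
    P.IsPrime := by
  have key : ∀ x, x ∉ P.carrier → ∃ t ∈ (P.adjoin x).carrier, t ∈ T := by
    intro x hx
    by_contra! hcon
    have := P.mem_adjoin_self x
    rw [hmax _ (P.subset_adjoin x) hcon] at this
    exact hx this
  refine ⟨fun h => ?_, fun a b hab => ?_⟩
  · obtain ⟨t, ht⟩ := hne
    exact hP t (h ▸ Set.mem_univ t) ht
  · by_contra! hcon
    obtain ⟨s, hs, hsT⟩ := key a hcon.1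
    obtain ⟨t, ht, htT⟩ := key b hcon.2
    exact hP _ (P.mem_of_mem_adjoin_of_mem_adjoin hab (Filt.mem_of_le _ hs le_sup_left)
      (Filt.mem_of_le _ ht le_sup_right)) (hT s hsT t htT)

theorem exists_isMaximal {F : Filt A} (h : F.IsProper) :
    ∃ M : Filt A, M.IsMaximal ∧ F.carrier ⊆ M.carrier := by
  obtain ⟨M, hFM, hM, hmax⟩ := F.exists_maximal_disjoint {⊥} (by
    rintro x hx rfl
    exact (F.isProper_iff.1 h) hx)
  refine ⟨M, ⟨M.isProper_iff.2 fun hb => hM _ hb rfl, fun G hG hMG => hmax G hMG ?_⟩, hFM⟩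
  rintro x hx rfl
  exact G.isProper_iff.1 hG hx

theorem IsMaximal.bot_notMem {M : Filt A} (hM : M.IsMaximal) : ⊥ ∉ M.carrier :=
  M.isProper_iff.1 hM.1

theorem IsMaximal.isPrime {M : Filt A} (hM : M.IsMaximal) : M.IsPrime := by
  refine isPrime_of_maximal_disjoint (T := {⊥}) ⟨⊥, rfl⟩ ?_ ?_ ?_
  · rintro _ rfl _ rfl
    exact sup_idem _
  · rintro x hx rfl
    exact hM.bot_notMem hx
  · exact fun G hMG hG => hM.2 G (G.isProper_iff.2 fun h => hG _ h rfl) hMG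

/-- Otherwise `F.adjoin x` is proper and extends to a maximal filter containing both `F` and `x`. -/
theorem exists_mul_pow_eq_bot (F : Filt A) (x : A)
    (h : ∀ M : Filt A, M.IsMaximal → F.carrier ⊆ M.carrier → x ∉ M.carrier) :
    ∃ f ∈ F.carrier, ∃ k : ℕ, f * x ^ k = ⊥ := by
  by_contra! hcon
  obtain ⟨M, hM, hFM⟩ := exists_isMaximal (F := F.adjoin x) ((isProper_iff _).2 (by
    rintro ⟨f, hf, k, hk⟩
    exact hcon f hf k (le_bot_iff.1 hk)))
  exact h M hM ((F.subset_adjoin x).trans hFM) (hFM (F.mem_adjoin_self x))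

theorem exists_pow_eq_bot (x : A) (h : ∀ M : Filt A, M.IsMaximal → x ∉ M.carrier) :
    ∃ k : ℕ, x ^ k = ⊥ := by
  obtain ⟨f, rfl, k, hk⟩ := (trivialFilt A).exists_mul_pow_eq_bot x fun M hM _ => h M hM
  exact ⟨k, by simpa using hk⟩

theorem IsMaximal.exists_pow_himp_mem {M : Filt A} (hM : M.IsMaximal) {x : A}
    (hx : x ∉ M.carrier) : ∃ k : ℕ, x ^ k ⇨ ⊥ ∈ M.carrier := by
  obtain ⟨f, hf, k, hk⟩ := M.exists_mul_pow_eq_bot x fun N hN hMN => by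
    rwa [hM.2 N hN.1 hMN]
  exact ⟨k, (M.himp_mem_iff _ _).2 ⟨f, hf, hk.le⟩⟩

theorem IsMaximal.exists_mem_himp_mem {M N : Filt A} (hM : M.IsMaximal) (hN : N.IsMaximal)
    (hMN : M ≠ N) : ∃ x ∈ M.carrier, x ⇨ ⊥ ∈ N.carrier := by
  obtain ⟨x, hxM, hxN⟩ := Set.not_subset.1 fun h => hMN (hM.2 N hN.1 h).symm
  obtain ⟨k, hk⟩ := hN.exists_pow_himp_mem hxN
  exact ⟨x ^ k, M.pow_mem hxM k, hk⟩

theorem IsMaximal.compl_mem_iff {M : Filt A} (hM : M.IsMaximal) {a b : A} (h : a ⊔ b = 1)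
    (h' : a * b = ⊥) : b ∈ M.carrier ↔ a ∉ M.carrier := by
  refine ⟨fun hb ha => hM.bot_notMem (h' ▸ M.mul_mem ha hb), fun ha => ?_⟩
  exact (hM.isPrime.2 a b (h ▸ M.one_mem)).resolve_left ha

theorem mem_gen_of_mem {X : Set A} {x : A} (h : x ∈ X) : x ∈ (gen X).carrier :=
  fun _ hF => hF h

theorem gen_subset {X : Set A} {F : Filt A} (h : X ⊆ F.carrier) : (gen X).carrier ⊆ F.carrier :=
  fun _ hx => hx F h

theorem mem_principal_self (x : A) : x ∈ (principal x).carrier := mem_gen_of_mem rfl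

theorem principal_subset {x : A} {F : Filt A} (h : x ∈ F.carrier) :
    (principal x).carrier ⊆ F.carrier :=
  gen_subset (Set.singleton_subset_iff.2 h)

/-- The up-set of an idempotent is already a filter. -/
theorem mem_principal_iff_of_mul_self {x a : A} (hx : x * x = x) :
    a ∈ (principal x).carrier ↔ x ≤ a := by
  refine ⟨fun h => ?_, fun h => Filt.mem_of_le _ (mem_principal_self x) h⟩
  exact h ⟨{b | x ≤ b}, ⟨x, le_rfl⟩, fun ha hb => hx.symm.le.trans (mul_mono ha hb),
    fun ha hab => le_trans ha hab⟩ (Set.singleton_subset_iff.2 le_rfl)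

theorem toQuot_mul (F : Filt A) (a b : A) : F.toQuot (a * b) = F.toQuot a * F.toQuot b := rfl

theorem toQuot_sup (F : Filt A) (a b : A) : F.toQuot (a ⊔ b) = F.toQuot a ⊔ F.toQuot b := rfl

theorem toQuot_one (F : Filt A) : F.toQuot 1 = 1 := rfl

theorem toQuot_bot (F : Filt A) : F.toQuot ⊥ = ⊥ := rfl

theorem toQuot_surjective (F : Filt A) : Function.Surjective F.toQuot := Quotient.mk_surjective

theorem toQuot_le_iff (F : Filt A) (a b : A) : F.toQuot a ≤ F.toQuot b ↔ a ⇨ b ∈ F.carrier :=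
  Iff.rfl

theorem toQuot_mono (F : Filt A) {a b : A} (h : a ≤ b) : F.toQuot a ≤ F.toQuot b :=
  F.himp_mem_of_le h

theorem toQuot_eq_one_iff (F : Filt A) (a : A) : F.toQuot a = 1 ↔ a ∈ F.carrier := by
  rw [← toQuot_one]
  refine ⟨fun h => F.mem_of_himp_mem ((toQuot_le_iff F 1 a).1 h.ge) F.one_mem, fun h => ?_⟩
  refine le_antisymm (F.toQuot_mono (le_one' a)) ((F.himp_mem_iff _ _).2 ⟨a, h, ?_⟩)
  rw [mul_one]

theorem toQuot_pow (F : Filt A) (a : A) (k : ℕ) : F.toQuot (a ^ k) = F.toQuot a ^ k := by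
  induction k with
  | zero => simp [toQuot_one]
  | succ k ih => rw [pow_succ, pow_succ, toQuot_mul, ih]

/-- The preimage in `A` of a filter of `A/F`. -/
def comapQuot (F : Filt A) (G : Filt F.Quot) : Filt A where
  carrier := F.toQuot ⁻¹' G.carrier
  nonempty := ⟨1, G.one_mem⟩
  mul_mem := fun ha hb => G.mul_mem ha hb
  mem_of_le := fun ha hab => G.mem_of_le ha (F.toQuot_mono hab)

theorem subset_comapQuot (F : Filt A) (G : Filt F.Quot) :
    F.carrier ⊆ (F.comapQuot G).carrier := fun a ha => by
  change F.toQuot a ∈ G.carrier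
  rw [(F.toQuot_eq_one_iff a).2 ha]
  exact G.one_mem

theorem mem_cls_comapQuot (F : Filt A) (G : Filt F.Quot) (a x : A) :
    x ∈ (F.comapQuot G).cls a ↔ F.toQuot x ∈ G.cls (F.toQuot a) := Iff.rfl

/-- With `mem_cls_bot`, this lets the classes in `IsMaximalRL` prescribe which filters contain `x`
and which contain its negation. -/
theorem mem_cls_one (F : Filt A) (x : A) : x ∈ F.cls 1 ↔ x ∈ F.carrier := by
  rw [cls, Set.mem_ofPred_eq, ← toQuot_eq_iff, toQuot_one, toQuot_eq_one_iff]

theorem mem_cls_bot (F : Filt A) (x : A) : x ∈ F.cls ⊥ ↔ x ⇨ ⊥ ∈ F.carrier := by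
  rw [cls, Set.mem_ofPred_eq, rel_iff]
  exact and_iff_left (F.himp_mem_of_le bot_le)

end Filt

/-! ### Separation of maximal filters in Gelfand residuated lattices. -/

open Filt

variable {A : Type u} [ResiduatedLattice A]

/-- Take `a ∈ M \ N` and `b ∈ N \ M`, both `M` and `N` above `P`. The prime `P` contains `a ⇨ b` or
`b ⇨ a`, which forces `b ∈ M` or `a ∈ N`. -/
theorem isGelfand_of_prelinear (h : ∀ a b : A, (a ⇨ b) ⊔ (b ⇨ a) = 1) : IsGelfand A := by
  intro P hP
  obtain ⟨M, hM, hPM⟩ := exists_isMaximal hP.1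
  refine ⟨M, ⟨hM, hPM⟩, fun N ⟨hN, hPN⟩ => ?_⟩
  by_contra hne
  obtain ⟨a, haM, haN⟩ := Set.not_subset.1 fun k => hne (hM.2 N hN.1 k)
  obtain ⟨b, hbN, hbM⟩ := Set.not_subset.1 fun k => hne (hN.2 M hM.1 k).symm
  rcases hP.2 _ _ ((h a b).symm ▸ P.one_mem) with k | k
  · exact hbM (M.mem_of_himp_mem (hPM k) haM)
  · exact haN (N.mem_of_himp_mem (hPN k) hbN)

theorem IsBL.isGelfand (h : IsBL A) : IsGelfand A := isGelfand_of_prelinear h.1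

/-- If no such pair existed, a filter maximal among those avoiding all joins `a ⊔ b` with `a ∉ M`,
`b ∉ N` would be prime. Taking `a` or `b` to be `⊥` shows it lies in both `M` and `N`. -/
theorem IsGelfand.exists_sup_eq_one (h : IsGelfand A) {M N : Filt A} (hM : M.IsMaximal)
    (hN : N.IsMaximal) (hMN : M ≠ N) :
    ∃ a b : A, a ∉ M.carrier ∧ b ∉ N.carrier ∧ a ⊔ b = 1 := by
  by_contra! hcon
  set T : Set A := {x | ∃ a b : A, a ∉ M.carrier ∧ b ∉ N.carrier ∧ a ⊔ b = x}
  obtain ⟨P, -, hPT, hmax⟩ := (trivialFilt A).exists_maximal_disjoint T (by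
    rintro x rfl ⟨a, b, ha, hb, hab⟩
    exact hcon a b ha hb hab)
  have hP : P.IsPrime := by
    refine isPrime_of_maximal_disjoint (T := T)
      ⟨⊥ ⊔ ⊥, ⊥, ⊥, hM.bot_notMem, hN.bot_notMem, rfl⟩ ?_ hPT hmax
    rintro _ ⟨a, b, ha, hb, rfl⟩ _ ⟨c, d, hc, hd, rfl⟩
    refine ⟨a ⊔ c, b ⊔ d, fun k => ?_, fun k => ?_, sup_sup_sup_comm _ _ _ _⟩
    · exact (hM.isPrime.2 _ _ k).elim ha hc
    · exact (hN.isPrime.2 _ _ k).elim hb hd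
  have hPM : P.carrier ⊆ M.carrier := fun p hp => by
    by_contra hpM
    exact hPT p hp ⟨p, ⊥, hpM, hN.bot_notMem, sup_bot_eq p⟩
  have hPN : P.carrier ⊆ N.carrier := fun p hp => by
    by_contra hpN
    exact hPT p hp ⟨⊥, p, hM.bot_notMem, hpN, bot_sup_eq p⟩
  exact hMN ((h P hP).unique ⟨hM, hPM⟩ ⟨hN, hPN⟩)

/-- Elements to be kept out of one fixed maximal filter are joined, as it is prime; those to be kept
out of several are multiplied. Both preserve `a ⊔ b = 1`. -/
theorem IsGelfand.exists_sup_eq_one_of_finite (h : IsGelfand A) {S T : Set (Filt A)}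
    (hS : S.Finite) (hT : T.Finite) (hSm : ∀ M ∈ S, M.IsMaximal) (hTm : ∀ N ∈ T, N.IsMaximal)
    (hST : ∀ M ∈ S, M ∉ T) :
    ∃ a b : A, (∀ M ∈ S, a ∉ M.carrier) ∧ (∀ N ∈ T, b ∉ N.carrier) ∧ a ⊔ b = 1 := by
  have single : ∀ M : Filt A, M.IsMaximal → M ∉ T →
      ∃ a b : A, a ∉ M.carrier ∧ (∀ N ∈ T, b ∉ N.carrier) ∧ a ⊔ b = 1 := by
    clear hST
    intro M hM
    induction T, hT using Set.Finite.induction_on with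
    | empty => exact fun _ => ⟨⊥, 1, hM.bot_notMem, by simp, by simp [one_eq_top]⟩
    | @insert N T _ _ ih =>
      intro hMT
      obtain ⟨a, b, ha, hb, hab⟩ := ih (fun N hN => hTm N (Or.inr hN)) (fun k => hMT (Or.inr k))
      obtain ⟨c, d, hc, hd, hcd⟩ := h.exists_sup_eq_one hM (hTm N (Or.inl rfl))
        (fun k => hMT (Or.inl k))
      refine ⟨a ⊔ c, b * d, fun k => (hM.isPrime.2 _ _ k).elim ha hc, ?_, ?_⟩
      · rintro K (rfl | hK) hk
        · exact hd (K.mul_mem_iff.1 hk).2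
        · exact hb K hK (K.mul_mem_iff.1 hk).1
      · rw [sup_comm]
        refine mul_sup_eq_one ?_ ?_
        · rw [← sup_assoc, sup_comm b, hab, one_eq_top, top_sup_eq]
        · rw [sup_left_comm, sup_comm d, hcd, one_eq_top, sup_top_eq]
  induction S, hS using Set.Finite.induction_on with
  | empty => exact ⟨1, ⊥, by simp, fun N hN => (hTm N hN).bot_notMem, by simp⟩
  | @insert M S _ _ ih =>
    obtain ⟨a, b, ha, hb, hab⟩ := ih (fun N hN => hSm N (Or.inr hN)) (fun N hN => hST N (Or.inr hN))
    obtain ⟨c, d, hc, hd, hcd⟩ := single M (hSm M (Or.inl rfl)) (hST M (Or.inl rfl))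
    refine ⟨a * c, b ⊔ d, ?_, fun N hN k => ((hTm N hN).isPrime.2 _ _ k).elim (hb N hN) (hd N hN),
      ?_⟩
    · rintro K (rfl | hK) hk
      · exact hc (K.mul_mem_iff.1 hk).2
      · exact ha K hK (K.mul_mem_iff.1 hk).1
    · refine mul_sup_eq_one ?_ ?_
      · rw [← sup_assoc, hab, one_eq_top, top_sup_eq]
      · rw [sup_left_comm, hcd, one_eq_top, sup_top_eq]

/-- In a semilocal Gelfand residuated lattice, every set of maximal filters is the trace of a
complemented element. -/
theorem IsGelfand.exists_compl (h : IsGelfand A) (hA : IsSemilocal A) (S : Set (Filt A)) :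
    ∃ e e' : A, e ⊔ e' = 1 ∧ e * e' = ⊥ ∧
      ∀ N : Filt A, N.IsMaximal → (e ∈ N.carrier ↔ N ∈ S) := by
  obtain ⟨a, b, ha, hb, hab⟩ := h.exists_sup_eq_one_of_finite
    (S := {M | M.IsMaximal} ∩ S) (T := {M | M.IsMaximal} \ S)
    (hA.subset Set.inter_subset_left) (hA.subset Set.sdiff_subset)
    (fun M hM => hM.1) (fun M hM => hM.1) (fun M hM hM' => hM'.2 hM.2)
  -- Each maximal filter omits `a` or `b`, hence the product.
  obtain ⟨k, hk⟩ := exists_pow_eq_bot (a * b) fun M hM hab => by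
    by_cases hMS : M ∈ S
    · exact ha M ⟨hM, hMS⟩ (M.mul_mem_iff.1 hab).1
    · exact hb M ⟨hM, hMS⟩ (M.mul_mem_iff.1 hab).2
  have h1 : b ^ k ⊔ a ^ k = 1 := pow_sup_pow_eq_one (sup_comm a b ▸ hab) k k
  have h2 : b ^ k * a ^ k = ⊥ := by rw [← mul_pow, mul_comm, hk]
  refine ⟨b ^ k, a ^ k, h1, h2, fun N hN => ?_⟩
  -- `k = 0` would give `1 = ⊥`, impossible in the presence of the maximal filter `N`.
  have hk0 : k ≠ 0 := by
    rintro rfl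
    rw [pow_zero] at hk
    exact hN.bot_notMem (hk ▸ N.one_mem)
  refine ⟨fun hbN => ?_, fun hNS => ?_⟩
  · by_contra hNS
    exact hb N ⟨hN, hNS⟩ (N.mem_of_pow_mem hk0 hbN)
  · by_contra hbN
    exact ha N ⟨hN, hNS⟩ (N.mem_of_pow_mem hk0 ((hN.compl_mem_iff h1 h2).2 hbN))

/-! ### The Boolean Lifting Property and (⋆). -/

theorem IsSemilocal.hasBLP (hA : IsSemilocal A) (h : IsGelfand A) : HasBLP A := by
  rintro F a ⟨β, hβ⟩
  obtain ⟨b, rfl⟩ := F.toQuot_surjective β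
  have hsup := sup_eq_one_of_isCompl hβ
  have hmul := mul_eq_bot_of_isCompl hβ
  have hmul' : F.toQuot b * F.toQuot a = ⊥ := by rw [mul_comm, hmul]
  obtain ⟨e, e', he, hee, hmem⟩ := h.exists_compl hA {N | a ∈ N.carrier}
  have hee' : e' * e = ⊥ := by rw [mul_comm, hee]
  -- An idempotent of `A/F` avoiding all maximal filters above `F` is nilpotent, hence zero. Applied
  -- to `a * e'` and `e * b`, it yields the two inequalities between `a/F` and `e/F`.
  have key : ∀ x : A, F.toQuot x * F.toQuot x = F.toQuot x →
      (∀ M : Filt A, M.IsMaximal → F.carrier ⊆ M.carrier → x ∉ M.carrier) →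
      F.toQuot x = ⊥ := by
    intro x hx hxM
    obtain ⟨f, hf, k, hk⟩ := F.exists_mul_pow_eq_bot x hxM
    refine eq_bot_of_pow_eq_bot hx (k := k) ?_
    rw [← toQuot_bot, ← hk, toQuot_mul, toQuot_pow, (F.toQuot_eq_one_iff f).2 hf, one_mul]
  have hea : F.toQuot e * F.toQuot e = F.toQuot e := by
    rw [← toQuot_mul, mul_self_of_compl he hee]
  have hea' : F.toQuot e' * F.toQuot e' = F.toQuot e' := by
    rw [← toQuot_mul, mul_self_of_compl (sup_comm e e' ▸ he) hee']
  refine ⟨e, ⟨e', isCompl_of_mul he hee⟩, le_antisymm ?_ ?_⟩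
  · refine le_of_mul_eq_bot (c := F.toQuot e') (by rw [← toQuot_sup, he, toQuot_one])
      (key (a * e') (mul_mul_self (mul_self_of_compl hsup hmul) hea') fun M hM _ hx => ?_)
    obtain ⟨ha, he'⟩ := M.mul_mem_iff.1 hx
    exact (hM.compl_mem_iff he hee).1 he' ((hmem M hM).2 ha)
  · refine le_of_mul_eq_bot (c := F.toQuot b) hsup
      (key (e * b) (mul_mul_self hea (mul_self_of_compl (sup_comm _ (F.toQuot b) ▸ hsup) hmul'))
        fun M hM hFM hx => ?_)
    obtain ⟨he', hb⟩ := M.mul_mem_iff.1 hx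
    -- Since `e ∈ M` forces `a ∈ M`, the filter `M` would contain both `a * b` and its negation.
    have hab : a * b ⇨ ⊥ ∈ F.carrier := (F.toQuot_le_iff (a * b) ⊥).1 hmul.le
    exact hM.bot_notMem (M.mem_of_himp_mem (hFM hab) (M.mul_mem ((hmem M hM).1 he') hb))

theorem IsSemilocal.hasStar (hA : IsSemilocal A) (h : IsGelfand A) : HasStar A := by
  intro x
  obtain ⟨e, e', he, hee, hmem⟩ := h.exists_compl hA {N | x ∈ N.carrier}
  -- Take `u = x ⊔ e'`: a maximal filter without `x` omits `e`, so contains `e'`. Moreover `e * u =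
  -- e * x ≤ x`.
  refine ⟨x ⊔ e', fun M hM => ?_, e, ⟨e', isCompl_of_mul he hee⟩, ?_⟩
  · by_cases hx : x ∈ M.carrier
    · exact M.mem_of_le hx le_sup_left
    · exact M.mem_of_le ((hM.compl_mem_iff he hee).2 fun k => hx ((hmem M hM).1 k)) le_sup_right
  -- Nilpotency of `x * e'` places a power of `x` below `e`, so `e ∈ [x)`.
  · obtain ⟨k, hk⟩ := exists_pow_eq_bot (x * e') fun M hM hx => by
      obtain ⟨hx, he'⟩ := M.mul_mem_iff.1 hx
      exact (hM.compl_mem_iff he hee).1 he' ((hmem M hM).2 hx)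
    have hxe : x ^ k ≤ e := by
      refine le_of_mul_eq_bot he (le_antisymm ?_ bot_le)
      rw [← hk, mul_pow]
      exact mul_le_mul_l (le_pow_of_mul_self
        (mul_self_of_compl (sup_comm e e' ▸ he) (mul_comm e e' ▸ hee)) k) _
    refine Filt.ext (Set.Subset.antisymm (principal_subset ?_) (gen_subset (Set.union_subset
      (principal_subset ?_) (principal_subset ?_))))
    · refine Filt.mem_of_le _ (Filt.mul_mem _
        (mem_gen_of_mem (Or.inr (mem_principal_self e)))
        (mem_gen_of_mem (Or.inl (mem_principal_self (x ⊔ e'))))) ?_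
      rw [mul_sup_distrib, hee, sup_bot_eq]
      exact mul_le_snd _ _
    · exact Filt.mem_of_le _ (mem_principal_self x) le_sup_left
    · exact Filt.mem_of_le _ (Filt.pow_mem _ (mem_principal_self x) k) hxe

/-! ### Maximal residuated lattices are semilocal. -/

/-- A Chinese remainder statement for the values `1` on `S` and `⊥` on `T`, valid without the
Gelfand property. It supplies the finite intersections in `IsMaximalRL.exists_mem_himp_mem`. -/
theorem exists_mem_himp_mem_of_finite {S T : Set (Filt A)} (hS : S.Finite) (hT : T.Finite)
    (hSm : ∀ M ∈ S, M.IsMaximal) (hTm : ∀ N ∈ T, N.IsMaximal) (hST : ∀ M ∈ S, M ∉ T) :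
    ∃ x : A, (∀ M ∈ S, x ∈ M.carrier) ∧ ∀ N ∈ T, x ⇨ ⊥ ∈ N.carrier := by
  have single : ∀ M : Filt A, M.IsMaximal → M ∉ T →
      ∃ x ∈ M.carrier, ∀ N ∈ T, x ⇨ ⊥ ∈ N.carrier := by
    clear hST
    intro M hM
    induction T, hT using Set.Finite.induction_on with
    | empty => exact fun _ => ⟨1, M.one_mem, by simp⟩
    | @insert N T _ _ ih =>
      intro hMT
      obtain ⟨x, hx, hxT⟩ := ih (fun N hN => hTm N (Or.inr hN)) (fun k => hMT (Or.inr k))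
      obtain ⟨y, hy, hyN⟩ := hM.exists_mem_himp_mem (hTm N (Or.inl rfl))
        (fun k => hMT (Or.inl k))
      refine ⟨x * y, M.mul_mem hx hy, ?_⟩
      rintro K (rfl | hK)
      · exact K.himp_mem_trans (K.himp_mem_of_le (mul_le_snd x y)) hyN
      · exact K.himp_mem_trans (K.himp_mem_of_le (mul_le_fst x y)) (hxT K hK)
  induction S, hS using Set.Finite.induction_on with
  | empty => exact ⟨⊥, by simp, fun N _ => N.himp_mem_of_le le_rfl⟩
  | @insert M S _ _ ih =>
    obtain ⟨x, hx, hxT⟩ := ih (fun N hN => hSm N (Or.inr hN)) (fun N hN => hST N (Or.inr hN))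
    obtain ⟨y, hy, hyT⟩ := single M (hSm M (Or.inl rfl)) (hST M (Or.inl rfl))
    refine ⟨x ⊔ y, ?_, fun N hN => N.himp_mem_sup (hxT N hN) (hyT N hN)⟩
    rintro K (rfl | hK)
    · exact K.mem_of_le hy le_sup_right
    · exact K.mem_of_le (hx K hK) le_sup_left

theorem IsMaximalRL.exists_mem_himp_mem (h : IsMaximalRL A) (S : Set (Filt A)) :
    ∃ x : A, ∀ M : Filt A, M.IsMaximal →
      (M ∈ S → x ∈ M.carrier) ∧ (M ∉ S → x ⇨ ⊥ ∈ M.carrier) := by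
  classical
  by_cases hne : Nonempty {M : Filt A // M.IsMaximal}
  · obtain ⟨x, hx⟩ := h {M : Filt A // M.IsMaximal} (fun M => if M.1 ∈ S then 1 else ⊥)
      (fun M => M.1) fun J => by
        obtain ⟨x, hx, hx'⟩ := exists_mem_himp_mem_of_finite
          (S := (Subtype.val '' (J : Set {M : Filt A // M.IsMaximal})) ∩ S)
          (T := (Subtype.val '' (J : Set {M : Filt A // M.IsMaximal})) \ S)
          ((J.finite_toSet.image _).subset Set.inter_subset_left)
          ((J.finite_toSet.image _).subset Set.sdiff_subset)
          (by rintro _ ⟨⟨M, -, rfl⟩, -⟩; exact M.2) (by rintro _ ⟨⟨M, -, rfl⟩, -⟩; exact M.2)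
          (fun M hM hM' => hM'.2 hM.2)
        refine ⟨x, Set.mem_iInter₂.2 fun M hM => ?_⟩
        split_ifs with hMS
        · exact (mem_cls_one _ _).2 (hx _ ⟨⟨M, hM, rfl⟩, hMS⟩)
        · exact (mem_cls_bot _ _).2 (hx' _ ⟨⟨M, hM, rfl⟩, hMS⟩)
    refine ⟨x, fun M hM => ?_⟩
    have hxM := Set.mem_iInter.1 hx ⟨M, hM⟩
    refine ⟨fun hMS => ?_, fun hMS => ?_⟩
    · simpa [hMS, mem_cls_one] using hxM
    · simpa [hMS, mem_cls_bot] using hxM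
  -- Without maximal filters the index set would be empty, which `IsMaximalRL` excludes.
  · exact ⟨1, fun M hM => (hne ⟨M, hM⟩).elim⟩

/-- The elements that belong to all but finitely many maximal filters. -/
def cofiniteFilt (A : Type u) [ResiduatedLattice A] : Filt A where
  carrier := {a | {M : Filt A | M.IsMaximal ∧ a ∉ M.carrier}.Finite}
  nonempty := ⟨1, Set.Finite.subset Set.finite_empty fun M hM => hM.2 M.one_mem⟩
  mul_mem := fun {a b} ha hb => (Set.Finite.union ha hb).subset fun M hM => by
    by_contra hcon
    simp only [Set.mem_union, Set.mem_ofPred_eq, hM.1, true_and, not_or, not_not] at hcon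
    exact hM.2 (M.mul_mem hcon.1 hcon.2)
  mem_of_le := fun ha hab => Set.Finite.subset ha fun M hM =>
    ⟨hM.1, fun k => hM.2 (M.mem_of_le k hab)⟩

/-- The classes `1/M`, for all maximal `M`, and `⊥/cofiniteFilt A` have the finite intersection
property. A common element lies in every `M`, yet its negation lies in all but finitely many; no
proper filter contains both. -/
theorem IsMaximalRL.isSemilocal (h : IsMaximalRL A) : IsSemilocal A := by
  classical
  obtain ⟨x, hx⟩ := h (Option {M : Filt A // M.IsMaximal})
    (fun i => i.elim ⊥ fun _ => 1) (fun i => i.elim (cofiniteFilt A) fun M => M.1) fun J => by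
      obtain ⟨x, hx⟩ := h.exists_mem_himp_mem {M | ∃ hM : M.IsMaximal, some ⟨M, hM⟩ ∈ J}
      refine ⟨x, Set.mem_iInter₂.2 fun i hi => ?_⟩
      cases i with
      | none =>
        refine (mem_cls_bot _ _).2 ?_
        -- The negation of `x` can fail only in maximal filters indexed by `J`.
        refine (J.eraseNone.finite_toSet.image Subtype.val).subset fun M hM => ?_
        by_contra hcon
        refine hM.2 ((hx M hM.1).2 fun ⟨hM', hMJ⟩ => hcon ⟨⟨M, hM'⟩, by simpa using hMJ, rfl⟩)
      | some M => exact (mem_cls_one _ _).2 ((hx M.1 M.2).1 ⟨M.2, hi⟩)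
  have h1 := (mem_cls_bot _ _).1 (Set.mem_iInter.1 hx none)
  refine Set.Finite.subset h1 fun M hM => ⟨hM, fun hM' => ?_⟩
  have h2 := (mem_cls_one _ _).1 (Set.mem_iInter.1 hx (some ⟨M, hM⟩))
  exact hM.bot_notMem (M.mem_of_himp_mem hM' h2)

theorem IsMaximalRL.quot (h : IsMaximalRL A) (F : Filt A) : IsMaximalRL F.Quot := by
  intro I _ a G hJ
  choose b hb using fun i => F.toQuot_surjective (a i)
  obtain ⟨x, hx⟩ := h I b (fun i => F.comapQuot (G i)) fun J => by
    obtain ⟨q, hq⟩ := hJ J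
    obtain ⟨x, rfl⟩ := F.toQuot_surjective q
    refine ⟨x, Set.mem_iInter₂.2 fun i hi => ?_⟩
    rw [mem_cls_comapQuot, hb]
    exact Set.mem_iInter₂.1 hq i hi
  refine ⟨F.toQuot x, Set.mem_iInter.2 fun i => ?_⟩
  rw [← hb, ← mem_cls_comapQuot]
  exact Set.mem_iInter.1 hx i

/-! ### Decomposition into local factors. -/

/-- All maximal filters of `A/F` pull back inside `M`. Two distinct ones would put some `x` and its
negation in `M`. -/
theorem isLocal_quot {F M : Filt A} (hF : F.IsProper)
    (h : ∀ N : Filt A, N.IsMaximal → F.carrier ⊆ N.carrier → N = M) : IsLocal F.Quot := by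
  obtain ⟨K, hK, -⟩ := exists_isMaximal (F := trivialFilt F.Quot) ((isProper_iff _).2 fun hb => by
    exact F.isProper_iff.1 hF ((F.toQuot_eq_one_iff ⊥).1 hb))
  have key : ∀ L : Filt F.Quot, L.IsMaximal →
      M.IsMaximal ∧ (F.comapQuot L).carrier ⊆ M.carrier := by
    intro L hL
    obtain ⟨N, hN, hLN⟩ := exists_isMaximal (F := F.comapQuot L)
      ((isProper_iff _).2 hL.bot_notMem)
    obtain rfl := h N hN ((F.subset_comapQuot L).trans hLN)
    exact ⟨hN, hLN⟩
  refine ⟨K, hK, fun L hL => ?_⟩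
  by_contra hne
  obtain ⟨q, hqL, hqK⟩ := hL.exists_mem_himp_mem hK hne
  obtain ⟨x, rfl⟩ := F.toQuot_surjective q
  exact (key K hK).1.bot_notMem (M.mem_of_himp_mem ((key K hK).2 hqK) ((key L hL).2 hqL))

/-- A residuated lattice is the product of its quotients by the principal filters generated by
finitely many pairwise orthogonal idempotents with join `1`. -/
theorem nonempty_iso_pi_quot {n : ℕ} (f : Fin n → A) (hidem : ∀ i, f i * f i = f i)
    (horth : ∀ i j, i ≠ j → f i * f j = ⊥) (hsup : Finset.univ.sup f = 1) :
    Nonempty (Iso A (∀ i, (principal (f i)).Quot)) := by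
  refine ⟨{ Equiv.ofBijective (fun a i => (principal (f i)).toQuot a) ⟨?_, ?_⟩ with
    map_sup := fun _ _ => rfl
    map_inf := fun _ _ => rfl
    map_mul := fun _ _ => rfl
    map_himp := fun _ _ => rfl
    map_bot := rfl
    map_one := rfl }⟩
  · intro a b hab
    have key : ∀ c d : A, (∀ i, (principal (f i)).toQuot c ≤ (principal (f i)).toQuot d) →
        c ≤ d := by
      intro c d hcd
      -- The residuum is above every `f i`, hence above their join `1`.
      have : (1 : A) ≤ c ⇨ d := hsup ▸ Finset.sup_le fun i _ =>
        (mem_principal_iff_of_mul_self (hidem i)).1 (hcd i)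
      simpa using (residuation _ _ _).1 this
    exact le_antisymm (key a b fun i => (congrFun hab i).le) (key b a fun i => (congrFun hab i).ge)
  · intro q
    choose a ha using fun i => (principal (f i)).toQuot_surjective (q i)
    -- Modulo `[f i)` the terms with `j ≠ i` vanish by orthogonality and `f i` becomes `1`.
    refine ⟨Finset.univ.sup fun i => a i * f i, funext fun i => ?_⟩
    rw [← ha i]
    refine le_antisymm ?_ ?_ <;>
      rw [toQuot_le_iff, himp_mem_iff] <;>
      refine ⟨f i, mem_principal_self _, ?_⟩ <;>
      rw [mul_comm]
    · rw [← residuation]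
      refine Finset.sup_le fun j _ => ?_
      rw [residuation, mul_assoc]
      rcases eq_or_ne j i with rfl | hji
      · exact mul_le_fst _ _
      · rw [horth j i hji, mul_bot_eq]
        exact bot_le
    · exact Finset.le_sup (f := fun i => a i * f i) (Finset.mem_univ i)

theorem IsSemilocal.exists_iso_pi_quot (hA : IsSemilocal A) (h : IsGelfand A) :
    ∃ (n : ℕ) (F : Fin n → Filt A), (∀ i, IsLocal (F i).Quot) ∧
      Nonempty (Iso A (∀ i, (F i).Quot)) := by
  have : Finite {M : Filt A // M.IsMaximal} := hA.to_subtype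
  obtain ⟨n, ⟨φ⟩⟩ := Finite.exists_equiv_fin {M : Filt A // M.IsMaximal}
  choose f e hfe hmul hmem using fun i => h.exists_compl hA {(φ.symm i).1}
  have hidem i : f i * f i = f i := mul_self_of_compl (hfe i) (hmul i)
  refine ⟨n, fun i => principal (f i), fun i => ?_, nonempty_iso_pi_quot f hidem ?_ ?_⟩
  · have hfi : f i ∈ (φ.symm i).1.carrier := (hmem i _ (φ.symm i).2).2 rfl
    refine isLocal_quot (M := (φ.symm i).1) ((isProper_iff _).2 fun hb =>
      (φ.symm i).2.bot_notMem (principal_subset hfi hb)) fun N hN hfN => ?_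
    exact (hmem i N hN).1 (hfN (mem_principal_self _))
  · intro i j hij
    obtain ⟨k, hk⟩ := exists_pow_eq_bot (f i * f j) fun N hN hx => by
      obtain ⟨hi, hj⟩ := N.mul_mem_iff.1 hx
      have hi' : N = (φ.symm i).1 := (hmem i N hN).1 hi
      have hj' : N = (φ.symm j).1 := (hmem j N hN).1 hj
      exact hij (φ.symm.injective (Subtype.ext (hi'.symm.trans hj')))
    exact eq_bot_of_pow_eq_bot (mul_mul_self (hidem i) (hidem j)) hk
  -- It remains to kill `∏ i, e i`: it is idempotent and in no maximal filter, since the filter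
  -- numbered `i` contains `f i` and so omits `e i`. For `n = 0` the product is `1`, and this says
  -- `1 = ⊥`.
  · have hsup : (∏ i, e i) ⊔ Finset.univ.sup f = 1 := by
      refine Finset.prod_induction e (fun x => x ⊔ Finset.univ.sup f = 1)
        (fun a b => mul_sup_eq_one) (by simp [one_eq_top]) fun i _ => ?_
      refine le_antisymm (le_one' _) ?_
      rw [← hfe i, sup_comm]
      exact sup_le_sup_left (Finset.le_sup (Finset.mem_univ i)) _
    obtain ⟨k, hk⟩ := exists_pow_eq_bot (∏ i, e i) fun N hN hx => by
      have hi : e (φ ⟨N, hN⟩) ∈ N.carrier :=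
        N.mem_of_le hx (le_of_dvd' (Finset.dvd_prod_of_mem e (Finset.mem_univ _)))
      exact (hN.compl_mem_iff (hfe _) (hmul _)).1 hi ((hmem _ N hN).2 (by simp))
    have hprod : (∏ i, e i) * ∏ i, e i = ∏ i, e i := by
      rw [← Finset.prod_mul_distrib]
      exact Finset.prod_congr rfl fun i _ =>
        mul_self_of_compl (sup_comm (f i) (e i) ▸ hfe i) (mul_comm (f i) (e i) ▸ hmul i)
    rwa [eq_bot_of_pow_eq_bot hprod hk, bot_sup_eq] at hsup

end ResiduatedLattice

theorem mainTheorem9 (A : Type u) [ResiduatedLattice A] :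
    ((ResiduatedLattice.IsSemilocal A → ResiduatedLattice.IsGelfand A →
        ResiduatedLattice.HasBLP A) ∧
      (ResiduatedLattice.IsSemilocal A → ResiduatedLattice.IsMV A →
        ResiduatedLattice.HasBLP A) ∧
      (ResiduatedLattice.IsSemilocal A → ResiduatedLattice.IsBL A →
        ResiduatedLattice.HasBLP A) ∧
      (ResiduatedLattice.IsMaximalRL A → ResiduatedLattice.IsGelfand A →
        ResiduatedLattice.HasBLP A)) ∧
    ((ResiduatedLattice.IsSemilocal A → ResiduatedLattice.IsGelfand A →
        ResiduatedLattice.HasStar A) ∧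
      (ResiduatedLattice.IsSemilocal A → ResiduatedLattice.IsMV A →
        ResiduatedLattice.HasStar A) ∧
      (ResiduatedLattice.IsSemilocal A → ResiduatedLattice.IsBL A →
        ResiduatedLattice.HasStar A) ∧
      (ResiduatedLattice.IsMaximalRL A → ResiduatedLattice.IsGelfand A →
        ResiduatedLattice.HasStar A)) ∧
    (ResiduatedLattice.IsSemilocal A → ResiduatedLattice.IsGelfand A →
      ∃ (n : ℕ) (B : Fin n → Type u) (_ : ∀ i, ResiduatedLattice (B i)),
        (∀ i, ResiduatedLattice.IsLocal (B i)) ∧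
        Nonempty (ResiduatedLattice.Iso A (∀ i, B i))) ∧
    (ResiduatedLattice.IsMaximalRL A → ResiduatedLattice.IsGelfand A →
      ∃ (n : ℕ) (B : Fin n → Type u) (_ : ∀ i, ResiduatedLattice (B i)),
        (∀ i, ResiduatedLattice.IsLocal (B i) ∧ ResiduatedLattice.IsMaximalRL (B i)) ∧
        Nonempty (ResiduatedLattice.Iso A (∀ i, B i))) := by
  refine ⟨⟨fun hA h => hA.hasBLP h, fun hA h => hA.hasBLP h.1.isGelfand,
      fun hA h => hA.hasBLP h.isGelfand, fun hA h => hA.isSemilocal.hasBLP h⟩,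
    ⟨fun hA h => hA.hasStar h, fun hA h => hA.hasStar h.1.isGelfand,
      fun hA h => hA.hasStar h.isGelfand, fun hA h => hA.isSemilocal.hasStar h⟩,
    fun hA h => ?_, fun hA h => ?_⟩
  · obtain ⟨n, F, hF, hiso⟩ := hA.exists_iso_pi_quot h
    exact ⟨n, fun i => (F i).Quot, fun i => inferInstance, hF, hiso⟩
  · obtain ⟨n, F, hF, hiso⟩ := hA.isSemilocal.exists_iso_pi_quot h
    exact ⟨n, fun i => (F i).Quot, fun i => inferInstance, fun i => ⟨hF i, hA.quot (F i)⟩, hiso⟩
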